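/- Let $(M,\eta,g,\phi)$ be a contact metric manifold of dimension $2n+1$ with Reeb field $\xi$; that is, $\eta\wedge(d\eta)^n\ne0$ everywhere, $\eta(\xi)=1$, $d\eta(\xi,\cdot)=0$, $g(X,\xi)=\eta(X)$, $\phi^2=-I+\eta\otimes\xi$ and $d\eta(X,Y)=g(X,\phi Y)$, where $d\eta(X,Y)=\frac12\big(X\eta(Y)-Y\eta(X)-\eta([X,Y])\big)$. For $t\in\mathbb R$ let $M_t$ be $M\cong M\times\{t\}$ with the contact metric structure $\eta_t=e^{2t}\eta$, $g_t=e^{2t}g+e^{2t}(e^{2t}-1)\,\eta\otimes\eta$, $\phi_t=\phi$, and let $\bar g=g_t+dt^2$ be the metric of the metric symplectization $M\times\mathbb R$. Write $\overline{Ric}$ and $Ric^t$ for the Ricci tensors of $\bar g$ and $g_t$. A contact metric manifold is called $\eta$-Einstein if $Ric=\alpha g+\beta\,\eta\otimes\eta$ for some smooth functions $\alpha,\beta$. If $\overline{Ric}=(-2n-4)\,dt^2$, then for every $t\in\mathbb R$ the slice $M_t$ is $\eta_t$-Einstein; explicitly, $Ric^t=(2n+2)\,g_t+(2n+2)\,\eta_t\otimes\eta_t$.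 In particular, $M$ itself is $\eta$-Einstein. Moreover, without any assumption on $\overline{Ric}$, for every $t$ and all $X,Y$ tangent to $M_t$, $$Ric^t(X,Y)=\overline{Ric}(X,Y)+(2n+2)\,g_t(X,Y)+(2n+2)\,\eta_t(X)\eta_t(Y).$$ -/

import Mathlib

open Bundle Set
open scoped Manifold ContDiff Topology

set_option maxSynthPendingDepth 3

noncomputable section

/-! ### Curvature of a metric given on (an open subset of) a finite-dimensional vector space

A metric is a map `G : V → (V →L[ℝ] V →L[ℝ] ℝ)`. -/

namespace Coord

variable {V : Type*} [NormedAddCommGroup V] [NormedSpace ℝ V]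

/-- `(u, v) ↦ (w ↦ D_u G (v, w) + D_v G (u, w) - D_w G (u, v))` at `y`: twice the Christoffel
symbols of the first kind. -/
def christoffelFirst (G : V → V →L[ℝ] V →L[ℝ] ℝ) (y : V) : V →L[ℝ] V →L[ℝ] V →L[ℝ] ℝ :=
  let swap : (V →L[ℝ] V →L[ℝ] ℝ) →L[ℝ] (V →L[ℝ] V →L[ℝ] ℝ) :=
    (ContinuousLinearMap.flipₗᵢ ℝ V V ℝ).toContinuousLinearEquiv
  let D : V →L[ℝ] (V →L[ℝ] V →L[ℝ] ℝ) := fderiv ℝ G y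
  D + D.flip - swap.comp D.flip

theorem christoffelFirst_apply (G : V → V →L[ℝ] V →L[ℝ] ℝ) (y u v w : V) :
    christoffelFirst G y u v w
      = fderiv ℝ G y u v w + fderiv ℝ G y v u w - fderiv ℝ G y w u v := by
  simp [christoffelFirst]

/-- The Christoffel symbols `Γ_y(u, v) ∈ V` of the Levi-Civita connection of `G`, so that
`(∇_u W)(y) = D_u W (y) + Γ_y(u, W y)`. The inverse of `G y`, seen as a map `V → V*`, is a true
inverse as soon as `V` is finite-dimensional and `G y` is nondegenerate. -/
def christoffel (G : V → V →L[ℝ] V →L[ℝ] ℝ) (y : V) : V →L[ℝ] V →L[ℝ] V :=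
  (1 / 2 : ℝ) •
    (ContinuousLinearMap.compL ℝ V (V →L[ℝ] ℝ) V (ContinuousLinearMap.inverse (G y))).comp
      (christoffelFirst G y)

theorem christoffel_apply (G : V → V →L[ℝ] V →L[ℝ] ℝ) (y u v : V) :
    christoffel G y u v
      = (1 / 2 : ℝ) • ContinuousLinearMap.inverse (G y) (christoffelFirst G y u v) := by
  simp [christoffel]

/-- The Koszul formula, which characterizes the Levi-Civita connection. -/
theorem koszul [FiniteDimensional ℝ V] (G : V → V →L[ℝ] V →L[ℝ] ℝ) (y : V)
    (hG : ∀ v, v ≠ 0 → 0 < G y v v) (u v w : V) :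
    G y (christoffel G y u v) w
      = (1 / 2 : ℝ) * (fderiv ℝ G y u v w + fderiv ℝ G y v u w - fderiv ℝ G y w u v) := by
  have hinj : Function.Injective (G y : V →ₗ[ℝ] V →L[ℝ] ℝ) := by
    rw [← LinearMap.ker_eq_bot, LinearMap.ker_eq_bot']
    intro v hv
    by_contra hne
    have h1 := hG v hne
    have h2 : G y v = 0 := hv
    simp [h2] at h1
  have hdim : Module.finrank ℝ V = Module.finrank ℝ (V →L[ℝ] ℝ) := by
    rw [← (LinearMap.toContinuousLinearMap (𝕜 := ℝ) (E := V) (F' := ℝ)).finrank_eq]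
    exact (Subspace.dual_finrank_eq (K := ℝ) (V := V)).symm
  have : FiniteDimensional ℝ (V →L[ℝ] ℝ) := inferInstance
  let e : V ≃L[ℝ] (V →L[ℝ] ℝ) :=
    (LinearEquiv.ofInjectiveOfFinrankEq (G y : V →ₗ[ℝ] V →L[ℝ] ℝ) hinj hdim).toContinuousLinearEquiv
  have he : (e : V →L[ℝ] V →L[ℝ] ℝ) = G y := by
    ext v w
    rfl
  have hinv : ∀ l : V →L[ℝ] ℝ, G y (ContinuousLinearMap.inverse (G y) l) = l := by
    intro l
    rw [← he, ContinuousLinearMap.inverse_equiv]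
    exact e.apply_symm_apply l
  rw [christoffel_apply, map_smul, hinv, smul_apply, christoffelFirst_apply,
    smul_eq_mul]

/-- The curvature endomorphism `u ↦ R(u, v) w` at `y`, where
`R(X, Y) Z = ∇_X ∇_Y Z - ∇_Y ∇_X Z - ∇_[X, Y] Z`. -/
def curvature (G : V → V →L[ℝ] V →L[ℝ] ℝ) (y v w : V) : V →L[ℝ] V :=
  ((fderiv ℝ (christoffel G) y).flip v).flip w - (fderiv ℝ (christoffel G) y v).flip w
    + (christoffel G y).flip (christoffel G y v w)
    - (christoffel G y v).comp ((christoffel G y).flip w)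

theorem curvature_apply (G : V → V →L[ℝ] V →L[ℝ] ℝ) (y u v w : V) :
    curvature G y v w u
      = fderiv ℝ (christoffel G) y u v w - fderiv ℝ (christoffel G) y v u w
        + christoffel G y u (christoffel G y v w) - christoffel G y v (christoffel G y u w) := by
  simp [curvature]

/-- The Ricci tensor `Ric(v, w) = tr (u ↦ R(u, v) w)` at `y`. -/
def ricci (G : V → V →L[ℝ] V →L[ℝ] ℝ) (y v w : V) : ℝ :=
  LinearMap.trace ℝ V (curvature G y v w : V →ₗ[ℝ] V)

end Coord

/-! ### Tensors on manifolds, in the preferred charts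

In Mathlib `TangentSpace I x` is the model vector space `E`, through the derivative at `x` of the
preferred chart `extChartAt I x`. A tensor that is computed at `x` in that chart is therefore
directly a tensor on `TangentSpace I x`. Manifolds are without boundary here, so derivatives
in charts are ordinary derivatives. -/

section Manifold

variable {E : Type*} [NormedAddCommGroup E] [NormedSpace ℝ E]
  {H : Type*} [TopologicalSpace H] (I : ModelWithCorners ℝ E H)
  {M : Type*} [TopologicalSpace M] [ChartedSpace H M]

/-- The derivative at `y` of the inverse of the preferred chart at `x`. -/
def chartFrame (x : M) (y : E) : E →L[ℝ] TangentSpace I ((extChartAt I x).symm y) :=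
  mfderiv 𝓘(ℝ, E) I (extChartAt I x).symm y

/-- The 1-form `η` in the preferred chart at `x`. -/
def formInChart (η : (p : M) → TangentSpace I p →L[ℝ] ℝ) (x : M) (y : E) : E →L[ℝ] ℝ :=
  (η ((extChartAt I x).symm y)).comp (chartFrame I x y)

/-- The 2-tensor `g` in the preferred chart at `x`. -/
def tensorInChart (g : (p : M) → TangentSpace I p →L[ℝ] TangentSpace I p →L[ℝ] ℝ) (x : M) (y : E) :
    E →L[ℝ] E →L[ℝ] ℝ :=
  let A : E →L[ℝ] E := chartFrame I x y
  let B : E →L[ℝ] E →L[ℝ] ℝ := g ((extChartAt I x).symm y)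
  B.bilinearComp A A

theorem tensorInChart_apply
    (g : (p : M) → TangentSpace I p →L[ℝ] TangentSpace I p →L[ℝ] ℝ) (x : M) (y u v : E) :
    tensorInChart I g x y u v
      = g ((extChartAt I x).symm y) (chartFrame I x y u) (chartFrame I x y v) := rfl

/-- The exterior derivative of a 1-form, with the normalization usual in contact metric geometry:
`dη(X, Y) = (X(η(Y)) - Y(η(X)) - η([X, Y])) / 2`. -/
def exteriorDeriv (η : (p : M) → TangentSpace I p →L[ℝ] ℝ) (x : M) (u v : TangentSpace I x) : ℝ :=
  (1 / 2 : ℝ) * (fderiv ℝ (formInChart I η x) (extChartAt I x x) u v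
    - fderiv ℝ (formInChart I η x) (extChartAt I x x) v u)

theorem formInChart_smul (η : (p : M) → TangentSpace I p →L[ℝ] ℝ) (a : ℝ) (x : M) :
    formInChart I (fun p ↦ a • η p) x = a • formInChart I η x := rfl

theorem exteriorDeriv_smul (η : (p : M) → TangentSpace I p →L[ℝ] ℝ) (a : ℝ) (x : M)
    (u v : TangentSpace I x) :
    exteriorDeriv I (fun p ↦ a • η p) x u v = a * exteriorDeriv I η x u v := by
  have h : fderiv ℝ (a • formInChart I η x) (extChartAt I x x)
      = a • fderiv ℝ (formInChart I η x) (extChartAt I x x) :=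
    congrFun (fderiv_const_smul_field a) _
  have h' : ∀ w z : E, fderiv ℝ (a • formInChart I η x) (extChartAt I x x) w z
      = a * fderiv ℝ (formInChart I η x) (extChartAt I x x) w z := by
    intro w z
    rw [h]
    rfl
  rw [exteriorDeriv, exteriorDeriv, formInChart_smul]
  erw [h' u v, h' v u]
  ring

/-- The Ricci tensor of the Riemannian metric `g`. -/
def ricciTensor (g : (p : M) → TangentSpace I p →L[ℝ] TangentSpace I p →L[ℝ] ℝ) (x : M)
    (u v : TangentSpace I x) : ℝ :=
  Coord.ricci (tensorInChart I g x) (extChartAt I x x) u v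

/-- `η ∧ (dη)^n` vanishes nowhere: the alternating `(2n+1)`-form below is `η ∧ (dη)^n` up to a
positive constant that depends only on `n`. -/
def IsContactForm (n : ℕ) (η : (p : M) → TangentSpace I p →L[ℝ] ℝ) : Prop :=
  ∀ p : M, ∃ v : Fin (2 * n + 1) → TangentSpace I p,
    ∑ σ : Equiv.Perm (Fin (2 * n + 1)), ((Equiv.Perm.sign σ : ℤ) : ℝ) *
      (η p (v (σ 0)) * ∏ i : Fin n, exteriorDeriv I η p
        (v (σ ⟨2 * i + 1, by omega⟩)) (v (σ ⟨2 * i + 2, by omega⟩))) ≠ 0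

variable (M) in
/-- A contact metric structure `(η, g, φ)`, with its Reeb field `ξ`, on a manifold `M` of
dimension `2n+1`. -/
structure ContactMetricStructure [IsManifold I ∞ M] (n : ℕ) where
  /-- the contact form `η` -/
  form : (p : M) → TangentSpace I p →L[ℝ] ℝ
  /-- the Reeb vector field `ξ` -/
  reeb : (p : M) → TangentSpace I p
  /-- the Riemannian metric `g` -/
  metric : ContMDiffRiemannianMetric I ∞ E (fun p : M ↦ TangentSpace I p)
  /-- the (1,1)-tensor `φ` -/
  phi : (p : M) → TangentSpace I p →L[ℝ] TangentSpace I p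
  smooth_form : ContMDiff I (I.prod 𝓘(ℝ, E →L[ℝ] ℝ)) ∞
    (fun p ↦ TotalSpace.mk' (E →L[ℝ] ℝ)
      (E := fun q : M ↦ (TangentSpace I q →L[ℝ] Bundle.Trivial M ℝ q)) p (form p))
  smooth_reeb : ContMDiff I (I.prod 𝓘(ℝ, E)) ∞
    (fun p ↦ TotalSpace.mk' E (E := fun q : M ↦ TangentSpace I q) p (reeb p))
  smooth_phi : ContMDiff I (I.prod 𝓘(ℝ, E →L[ℝ] E)) ∞
    (fun p ↦ TotalSpace.mk' (E →L[ℝ] E)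
      (E := fun q : M ↦ (TangentSpace I q →L[ℝ] TangentSpace I q)) p (phi p))
  contact : IsContactForm I n form
  form_reeb : ∀ p, form p (reeb p) = 1
  exteriorDeriv_reeb : ∀ p u, exteriorDeriv I form p (reeb p) u = 0
  metric_reeb : ∀ p u, metric.inner p u (reeb p) = form p u
  phi_phi : ∀ p u, phi p (phi p u) = -u + form p u • reeb p
  exteriorDeriv_eq : ∀ p u v, exteriorDeriv I form p u v = metric.inner p u (phi p v)

end Manifold

namespace ContactMetricStructure

variable {E : Type*} [NormedAddCommGroup E] [NormedSpace ℝ E]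
  {H : Type*} [TopologicalSpace H] {I : ModelWithCorners ℝ E H}
  {M : Type*} [TopologicalSpace M] [ChartedSpace H M] [IsManifold I ∞ M] {n : ℕ}

/-- `Ric = α g + β η ⊗ η` for smooth functions `α` and `β`. -/
def IsEtaEinstein (S : ContactMetricStructure I M n) : Prop :=
  ∃ α β : M → ℝ, ContMDiff I 𝓘(ℝ, ℝ) ∞ α ∧ ContMDiff I 𝓘(ℝ, ℝ) ∞ β ∧
    ∀ (x : M) (u v : TangentSpace I x), ricciTensor I S.metric.inner x u v
      = α x * S.metric.inner x u v + β x * (S.form x u * S.form x v)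

/-- The tensor `η ⊗ η`. -/
def formSq (S : ContactMetricStructure I M n) (p : M) :
    TangentSpace I p →L[ℝ] TangentSpace I p →L[ℝ] ℝ :=
  (S.form p).smulRight (S.form p)

theorem formSq_apply (S : ContactMetricStructure I M n) (p : M) (u v : TangentSpace I p) :
    S.formSq p u v = S.form p u * S.form p v := by
  simp [formSq]

theorem smooth_formSq (S : ContactMetricStructure I M n) :
    ContMDiff I (I.prod 𝓘(ℝ, E →L[ℝ] E →L[ℝ] ℝ)) ∞
      (fun p ↦ TotalSpace.mk' (E →L[ℝ] E →L[ℝ] ℝ)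
        (E := fun q : M ↦ (TangentSpace I q →L[ℝ] TangentSpace I q →L[ℝ] Bundle.Trivial M ℝ q)) p
        (S.formSq p)) := by
  intro x
  have h := S.smooth_form x
  rw [contMDiffAt_hom_bundle] at h ⊢
  refine ⟨h.1, ?_⟩
  have h2 := h.2
  have hs : ContDiff ℝ ∞ (fun l : E →L[ℝ] ℝ ↦ l.smulRight l) :=
    contDiff_id.smulRight contDiff_id
  refine (hs.contMDiff.contMDiffAt.comp x h2).congr_of_eventuallyEq ?_
  have hx : ∀ᶠ p in 𝓝 x, p ∈ (trivializationAt E (TangentSpace I) x).baseSet :=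
    (trivializationAt E (TangentSpace I) x).open_baseSet.mem_nhds
      (mem_baseSet_trivializationAt E (TangentSpace I) x)
  filter_upwards [hx] with p hp
  ext u v
  have h3 := inCoordinates_apply_eq₂ (F₁ := E) (F₂ := E) (F₃ := ℝ) (E₁ := TangentSpace I)
    (E₂ := TangentSpace I) (E₃ := Bundle.Trivial M ℝ) (ϕ := S.formSq p) (v := u) (w := v)
    hp hp (Set.mem_univ _)
  refine h3.trans ?_
  simp [ContinuousLinearMap.inCoordinates, formSq_apply]
  rw [Trivialization.symmL_apply _ hp, Trivialization.symmL_apply _ hp]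

theorem metric_sub_sq_nonneg (S : ContactMetricStructure I M n) (p : M) (u : TangentSpace I p) :
    S.form p u * S.form p u ≤ S.metric.inner p u u := by
  have h0 : ∀ w, 0 ≤ S.metric.inner p w w := fun w ↦ by
    rcases eq_or_ne w 0 with rfl | hw
    · simp
    · exact (S.metric.pos p w hw).le
  have h := h0 (u - S.form p u • S.reeb p)
  have h1 : S.metric.inner p (S.reeb p) u = S.form p u := by
    rw [S.metric.symm, S.metric_reeb]
  simp only [map_sub, map_smul, sub_apply, smul_apply, smul_eq_mul, S.metric_reeb, h1,
    S.form_reeb] at h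
  linarith

theorem form_phi (S : ContactMetricStructure I M n) (p : M) (u : TangentSpace I p) :
    S.form p (S.phi p u) = 0 := by
  rw [← S.metric_reeb, S.metric.symm, ← S.exteriorDeriv_eq, S.exteriorDeriv_reeb]

/-- The homothetic deformation `η' = a η`, `g' = a g + a (a - 1) η ⊗ η`, `φ' = φ`, with Reeb field
`ξ' = ξ / a`, of a contact metric structure, for `a > 0`. It is again a contact metric structure. -/
def homothety (S : ContactMetricStructure I M n) (a : ℝ) (ha : 0 < a) :
    ContactMetricStructure I M n where
  form p := a • S.form p
  reeb p := a⁻¹ • S.reeb p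
  metric :=
    { inner := fun p ↦ a • S.metric.inner p + (a * (a - 1)) • S.formSq p
      symm := fun p u v ↦ by
        simp only [add_apply, smul_apply, smul_eq_mul, formSq_apply]
        rw [S.metric.symm]
        ring
      pos := fun p u hu ↦ by
        simp only [add_apply, smul_apply, smul_eq_mul, formSq_apply]
        have h1 := S.metric_sub_sq_nonneg p u
        have h2 := S.metric.pos p u hu
        rcases eq_or_ne (S.form p u) 0 with h | h
        · rw [h]
          simp only [mul_zero, add_zero]
          positivity
        · have h3 : 0 < a * a * (S.form p u * S.form p u) :=
            mul_pos (mul_pos ha ha) (mul_self_pos.2 h)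
          nlinarith
      isVonNBounded := fun p ↦ by
        have h1 := S.metric_sub_sq_nonneg p
        set s : ℝ := a⁻¹ + 1 with hs
        have hs0 : 0 < s := by positivity
        have hsa : a * s = 1 + a := by rw [hs]; field_simp
        have hb := (S.metric.isVonNBounded p).image
          (s • ContinuousLinearMap.id ℝ (TangentSpace I p))
        refine hb.subset ?_
        intro u hu
        simp only [mem_ofPred_eq, add_apply, smul_apply, smul_eq_mul, formSq_apply] at hu
        refine ⟨s⁻¹ • u, ?_, ?_⟩
        · simp only [mem_ofPred_eq, map_smul, smul_apply, smul_eq_mul]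
          have h2 := h1 u
          have h3 : 0 ≤ S.form p u * S.form p u := mul_self_nonneg _
          have h4 : S.metric.inner p u u < s * s := by
            have h5 : a * a * S.metric.inner p u u < (a * s) * (a * s) := by
              have hA : 0 ≤ a * (S.metric.inner p u u - S.form p u * S.form p u) :=
                mul_nonneg ha.le (sub_nonneg.2 h2)
              have hB : 0 ≤ a * a * (S.form p u * S.form p u) := by positivity
              rw [hsa]
              nlinarith
            nlinarith [mul_pos ha ha]
          rw [← mul_assoc, ← mul_inv, inv_mul_lt_iff₀ (by positivity)]
          linarith
        · simp [smul_smul, hs0.ne']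
      contMDiff := by
        have h := (S.metric.contMDiff.const_smul_section (a := a)).add_section
          (S.smooth_formSq.const_smul_section (a := a * (a - 1)))
        exact h }
  phi := S.phi
  smooth_form := S.smooth_form.const_smul_section (a := a)
  smooth_reeb := S.smooth_reeb.const_smul_section (a := a⁻¹)
  smooth_phi := S.smooth_phi
  contact p := by
    obtain ⟨v, hv⟩ := S.contact p
    refine ⟨v, ?_⟩
    have h : ∀ σ : Equiv.Perm (Fin (2 * n + 1)), ((Equiv.Perm.sign σ : ℤ) : ℝ) *
      ((a • S.form p) (v (σ 0)) * ∏ i : Fin n, exteriorDeriv I (fun q ↦ a • S.form q) p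
        (v (σ ⟨2 * i + 1, by omega⟩)) (v (σ ⟨2 * i + 2, by omega⟩))) =
        (a * a ^ n) * (((Equiv.Perm.sign σ : ℤ) : ℝ) *
      (S.form p (v (σ 0)) * ∏ i : Fin n, exteriorDeriv I S.form p
        (v (σ ⟨2 * i + 1, by omega⟩)) (v (σ ⟨2 * i + 2, by omega⟩)))) := by
      intro σ
      simp only [exteriorDeriv_smul, Finset.prod_mul_distrib, Finset.prod_const, Finset.card_univ,
        Fintype.card_fin, smul_apply, smul_eq_mul]
      ring
    rw [Finset.sum_congr rfl (fun σ _ ↦ h σ), ← Finset.mul_sum]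
    exact mul_ne_zero (by positivity) hv
  form_reeb p := by
    simp [S.form_reeb, ha.ne']
  exteriorDeriv_reeb p u := by
    have h : exteriorDeriv I S.form p (a⁻¹ • S.reeb p) u
        = a⁻¹ * exteriorDeriv I S.form p (S.reeb p) u := by
      rw [S.exteriorDeriv_eq, S.exteriorDeriv_eq]
      simp
    rw [exteriorDeriv_smul, h, S.exteriorDeriv_reeb]
    simp
  metric_reeb p u := by
    simp only [add_apply, smul_apply, smul_eq_mul, formSq_apply, map_smul, S.metric_reeb,
      S.form_reeb]
    field_simp
    ring
  phi_phi p u := by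
    rw [S.phi_phi]
    simp [smul_smul, ha.ne', mul_comm]
  exteriorDeriv_eq p u v := by
    rw [exteriorDeriv_smul, S.exteriorDeriv_eq]
    simp [formSq_apply, S.form_phi]

/-- The contact metric structure `(η_t, g_t, φ)` on the slice `M_t = M × {t}` of the metric
symplectization, where `M × {t}` is identified with `M`: `η_t = e^(2t) η` and
`g_t = e^(2t) g + e^(2t) (e^(2t) - 1) η ⊗ η`. -/
def slice (S : ContactMetricStructure I M n) (t : ℝ) : ContactMetricStructure I M n :=
  S.homothety (Real.exp (2 * t)) (Real.exp_pos _)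

theorem slice_form (S : ContactMetricStructure I M n) (t : ℝ) (p : M) (u : TangentSpace I p) :
    (S.slice t).form p u = Real.exp (2 * t) * S.form p u := rfl

theorem slice_metric (S : ContactMetricStructure I M n) (t : ℝ) (p : M) (u v : TangentSpace I p) :
    (S.slice t).metric.inner p u v = Real.exp (2 * t) * S.metric.inner p u v
      + Real.exp (2 * t) * (Real.exp (2 * t) - 1) * (S.form p u * S.form p v) := by
  rw [← formSq_apply]
  rfl

/-- The 1-form `dt` on `M × ℝ`. -/
def dt (I : ModelWithCorners ℝ E H) (q : M × ℝ) :
    TangentSpace (I.prod 𝓘(ℝ, ℝ)) q →L[ℝ] ℝ :=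
  mfderiv (I.prod 𝓘(ℝ, ℝ)) 𝓘(ℝ, ℝ) Prod.snd q

/-- The metric `g_t + dt ⊗ dt` of the metric symplectization on `M × ℝ`. -/
def symplectizationMetric (S : ContactMetricStructure I M n) (q : M × ℝ) :
    TangentSpace (I.prod 𝓘(ℝ, ℝ)) q →L[ℝ] TangentSpace (I.prod 𝓘(ℝ, ℝ)) q →L[ℝ] ℝ :=
  let P : (E × ℝ) →L[ℝ] E := mfderiv (I.prod 𝓘(ℝ, ℝ)) I Prod.fst q
  let G : E →L[ℝ] E →L[ℝ] ℝ := (S.slice q.2).metric.inner q.1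
  let T : (E × ℝ) →L[ℝ] ℝ := dt I q
  G.bilinearComp P P + T.smulRight T

theorem symplectizationMetric_apply (S : ContactMetricStructure I M n) (x : M) (t : ℝ)
    (u v : TangentSpace I x) (a b : ℝ) :
    S.symplectizationMetric (x, t) (u, a) (v, b) = (S.slice t).metric.inner x u v + a * b := by
  have h1 : mfderiv (I.prod 𝓘(ℝ, ℝ)) I Prod.fst (x, t) = ContinuousLinearMap.fst ℝ E ℝ :=
    mfderiv_fst
  have h2 : dt I (x, t) = ContinuousLinearMap.snd ℝ E ℝ := mfderiv_snd
  simp only [symplectizationMetric, h1, h2]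
  rfl

end ContactMetricStructure

end

/-! Near a point, in a chart of `M` times the standard coordinate of `ℝ`, the symplectization metric
is `G_t + dt²`. For any such metric the `t`-lines are unit-speed geodesics normal to the slices, the
second fundamental form of a slice is `½ ∂_t G` up to sign, and the Gauss and Riccati equations
give, on vectors tangent to a slice with shape operator `A`, `Ric̄(v, w) = Ric^t(v, w) - tr A · ½
∂_t G(v, w) + ½ ∂_t G(Av, w) + ½ ∂_t G(v, Aw) - ½ ∂_t² G(v, w)`. This is `Coord.ricci_normalMetric`.

For `G_t = e^(2t) g + e^(2t) (e^(2t) - 1) η ⊗ η`, with `η` the `g`-dual of the unit vector `ξ`, one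
finds `½ ∂_t G = g_t + η_t ⊗ η_t`, hence `A = id + η ⊗ ξ`. This operator does not depend on `t`, so
differentiating `½ ∂_t G = G(A·, ·)` shows that the last three terms cancel. As `tr A = (2n+1) + 1`,
what remains is `Ric̄ = Ric^t - (2n+2)(g_t + η_t ⊗ η_t)`: see `Coord.ricci_normalMetric_expFamily`,
carried to the manifold by `ContactMetricStructure.ricciTensor_slice`. Under the curvature condition
`Ric̄` vanishes on slices, because `dt` does. -/

namespace LinearMap

/-- The trace of an endomorphism of `V × ℝ` in terms of its diagonal blocks. -/
theorem trace_prod_real {V : Type*} [AddCommGroup V] [Module ℝ V] [FiniteDimensional ℝ V]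
    (f : V × ℝ →ₗ[ℝ] V × ℝ) :
    trace ℝ (V × ℝ) f
      = trace ℝ V (LinearMap.fst ℝ V ℝ ∘ₗ f ∘ₗ LinearMap.inl ℝ V ℝ) + (f (0, 1)).2 := by
  -- Split `f` by columns. Cyclicity of the trace turns the first summand into the `V`-block; the
  -- second has rank one.
  have h : f = (f ∘ₗ LinearMap.inl ℝ V ℝ) ∘ₗ LinearMap.fst ℝ V ℝ
      + (LinearMap.snd ℝ V ℝ).smulRight (f (0, 1)) := by
    ext <;> simp [Prod.mk_zero_zero]
  conv_lhs => rw [h]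
  rw [map_add, trace_smulRight, trace_comp_comm']
  rfl

end LinearMap

/-! ### Metrics `G_t + dt²` on `V × ℝ`: Christoffel symbols and Ricci tensor -/

namespace Coord

variable {V : Type*} [NormedAddCommGroup V] [NormedSpace ℝ V]

/-- A positive definite bilinear form on a finite-dimensional space identifies it with its dual. -/
theorem exists_equiv_of_pos [FiniteDimensional ℝ V] (B : V →L[ℝ] V →L[ℝ] ℝ)
    (hB : ∀ v, v ≠ 0 → 0 < B v v) : ∃ e : V ≃L[ℝ] (V →L[ℝ] ℝ), (e : V →L[ℝ] V →L[ℝ] ℝ) = B := by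
  have hinj : Function.Injective (B : V →ₗ[ℝ] V →L[ℝ] ℝ) := by
    rw [← LinearMap.ker_eq_bot, LinearMap.ker_eq_bot']
    intro v hv
    by_contra hne
    have h1 := hB v hne
    have h2 : B v = 0 := hv
    simp [h2] at h1
  have hdim : Module.finrank ℝ V = Module.finrank ℝ (V →L[ℝ] ℝ) := by
    rw [← (LinearMap.toContinuousLinearMap (𝕜 := ℝ) (E := V) (F' := ℝ)).finrank_eq]
    exact (Subspace.dual_finrank_eq (K := ℝ) (V := V)).symm
  exact ⟨(LinearEquiv.ofInjectiveOfFinrankEq (B : V →ₗ[ℝ] V →L[ℝ] ℝ) hinj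
    hdim).toContinuousLinearEquiv, by ext v w; rfl⟩

theorem ext_of_pos [FiniteDimensional ℝ V] {B : V →L[ℝ] V →L[ℝ] ℝ}
    (hB : ∀ v, v ≠ 0 → 0 < B v v) {x y : V} (h : ∀ w, B x w = B y w) : x = y := by
  by_contra hne
  have h1 := hB (x - y) (sub_ne_zero.2 hne)
  have h2 : B x = B y := ContinuousLinearMap.ext h
  rw [map_sub B, h2, sub_self, zero_apply] at h1
  exact lt_irrefl _ h1

/-- Inversion is smooth at an invertible map, and the other factor involves only first derivatives
of `G`. Curvature formulas can then be obtained by differentiating identities between Christoffel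
symbols. -/
theorem differentiableAt_christoffel [FiniteDimensional ℝ V] {G : V → V →L[ℝ] V →L[ℝ] ℝ} {y : V}
    (hG : ContDiffAt ℝ 2 G y) (hpos : ∀ v, v ≠ 0 → 0 < G y v v) :
    DifferentiableAt ℝ (christoffel G) y := by
  have hD : DifferentiableAt ℝ (fderiv ℝ G) y :=
    (hG.fderiv_right (m := 1) (by norm_num)).differentiableAt (by norm_num)
  have hfirst : DifferentiableAt ℝ (christoffelFirst G) y := by
    have hflip : DifferentiableAt ℝ (fun z ↦ (fderiv ℝ G z).flip) y :=
      (ContinuousLinearMap.flipₗᵢ ℝ V V (V →L[ℝ] ℝ)).toContinuousLinearEquiv.differentiableAt.comp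
        y hD
    exact (hD.add hflip).sub ((differentiableAt_const _).clm_comp hflip)
  have hinv : DifferentiableAt ℝ (fun z ↦ ContinuousLinearMap.inverse (G z)) y := by
    obtain ⟨e, he⟩ := exists_equiv_of_pos (G y) hpos
    have h := contDiffAt_map_inverse (𝕜 := ℝ) (n := 1) e
    rw [he] at h
    exact (h.differentiableAt (by norm_num)).comp y (hG.differentiableAt (by norm_num))
  have h := ((ContinuousLinearMap.compL ℝ V (V →L[ℝ] ℝ) V).differentiableAt.comp y
    hinv).clm_comp hfirst
  exact h.const_smul (1 / 2 : ℝ)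

/-- The metric `G_t + dt ⊗ dt` on `V × ℝ`, for a family `G` of metrics on `V`. -/
noncomputable def normalMetric (G : V × ℝ → V →L[ℝ] V →L[ℝ] ℝ) (q : V × ℝ) :
    V × ℝ →L[ℝ] V × ℝ →L[ℝ] ℝ :=
  (G q).bilinearComp (ContinuousLinearMap.fst ℝ V ℝ) (ContinuousLinearMap.fst ℝ V ℝ)
    + (ContinuousLinearMap.snd ℝ V ℝ).smulRight (ContinuousLinearMap.snd ℝ V ℝ)

theorem normalMetric_apply (G : V × ℝ → V →L[ℝ] V →L[ℝ] ℝ) (q u v : V × ℝ) :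
    normalMetric G q u v = G q u.1 v.1 + u.2 * v.2 := by
  simp [normalMetric]

theorem normalMetric_pos {G : V × ℝ → V →L[ℝ] V →L[ℝ] ℝ} {q : V × ℝ}
    (h : ∀ v, v ≠ 0 → 0 < G q v v) (v : V × ℝ) (hv : v ≠ 0) : 0 < normalMetric G q v v := by
  rw [normalMetric_apply]
  rcases eq_or_ne v.1 0 with h1 | h1
  · have h2 : v.2 ≠ 0 := fun h2 ↦ hv (Prod.ext h1 h2)
    rw [h1, map_zero, zero_add]
    exact mul_self_pos.2 h2
  · exact add_pos_of_pos_of_nonneg (h _ h1) (mul_self_nonneg _)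

/-- Precomposition of both arguments of a bilinear form on `V` with `V × ℝ → V`. -/
noncomputable def pullbackFst (V : Type*) [NormedAddCommGroup V] [NormedSpace ℝ V] :
    (V →L[ℝ] V →L[ℝ] ℝ) →L[ℝ] (V × ℝ →L[ℝ] V × ℝ →L[ℝ] ℝ) :=
  (ContinuousLinearMap.compL ℝ (V × ℝ) V (V × ℝ →L[ℝ] ℝ)).flip (ContinuousLinearMap.fst ℝ V ℝ) ∘L
    ContinuousLinearMap.compL ℝ V (V →L[ℝ] ℝ) (V × ℝ →L[ℝ] ℝ)
      ((ContinuousLinearMap.compL ℝ (V × ℝ) V ℝ).flip (ContinuousLinearMap.fst ℝ V ℝ))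

/-- A fixed continuous linear map applied to `G`, plus a constant: regularity and derivatives of `G`
pass through directly. -/
theorem normalMetric_eq (G : V × ℝ → V →L[ℝ] V →L[ℝ] ℝ) :
    normalMetric G = fun q ↦ pullbackFst V (G q)
      + (ContinuousLinearMap.snd ℝ V ℝ).smulRight (ContinuousLinearMap.snd ℝ V ℝ) := by
  rfl

theorem contDiffAt_normalMetric {G : V × ℝ → V →L[ℝ] V →L[ℝ] ℝ} {q : V × ℝ}
    {m : WithTop ℕ∞} (hG : ContDiffAt ℝ m G q) : ContDiffAt ℝ m (normalMetric G) q := by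
  rw [normalMetric_eq]
  exact ((pullbackFst V).contDiff.contDiffAt.comp q hG).add contDiffAt_const

theorem fderiv_normalMetric_apply {G : V × ℝ → V →L[ℝ] V →L[ℝ] ℝ} {q : V × ℝ}
    (hG : DifferentiableAt ℝ G q) (u v w : V × ℝ) :
    fderiv ℝ (normalMetric G) q u v w = fderiv ℝ G q u v.1 w.1 := by
  have h : HasFDerivAt (normalMetric G) (pullbackFst V ∘L fderiv ℝ G q) q := by
    rw [normalMetric_eq]
    exact ((pullbackFst V).hasFDerivAt.comp q hG.hasFDerivAt).add_const _
  rw [h.fderiv]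
  rfl

theorem hasFDerivAt_apply₂ {X W F : Type*} [NormedAddCommGroup X] [NormedSpace ℝ X]
    [NormedAddCommGroup W] [NormedSpace ℝ W] [NormedAddCommGroup F] [NormedSpace ℝ F]
    {f : X → V →L[ℝ] W →L[ℝ] F} {x : X} (hf : DifferentiableAt ℝ f x) (a : V) (b : W) :
    HasFDerivAt (fun q ↦ f q a b) (((fderiv ℝ f x).flip a).flip b) x :=
  (ContinuousLinearMap.apply ℝ F b).hasFDerivAt.comp x
    ((ContinuousLinearMap.apply ℝ (W →L[ℝ] F) a).hasFDerivAt.comp x hf.hasFDerivAt)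

theorem hasFDerivAt_slice {F : Type*} [NormedAddCommGroup F] [NormedSpace ℝ F] {f : V × ℝ → F}
    {y : V} {s : ℝ} (hf : DifferentiableAt ℝ f (y, s)) :
    HasFDerivAt (fun z ↦ f (z, s)) (fderiv ℝ f (y, s) ∘L ContinuousLinearMap.inl ℝ V ℝ) y :=
  hf.hasFDerivAt.comp y (hasFDerivAt_prodMk_left y s)

section Normal

variable [FiniteDimensional ℝ V] {G : V × ℝ → V →L[ℝ] V →L[ℝ] ℝ} {y : V} {s : ℝ}

/-- The component of the Christoffel symbols of `G_t + dt ⊗ dt` normal to the slices. -/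
theorem christoffel_normalMetric_snd (hG : DifferentiableAt ℝ G (y, s))
    (hpos : ∀ v, v ≠ 0 → 0 < G (y, s) v v) (u v : V × ℝ) :
    (christoffel (normalMetric G) (y, s) u v).2
      = -((1 / 2 : ℝ) * fderiv ℝ G (y, s) (0, 1) u.1 v.1) := by
  have h := koszul (normalMetric G) (y, s) (normalMetric_pos hpos) u v (0, 1)
  simp only [fderiv_normalMetric_apply hG, normalMetric_apply, map_zero] at h
  linarith

/-- The component of the Christoffel symbols of `G_t + dt ⊗ dt` tangent to the slices. -/
theorem christoffel_normalMetric_fst (hG : DifferentiableAt ℝ G (y, s))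
    (hpos : ∀ v, v ≠ 0 → 0 < G (y, s) v v) {A : V →L[ℝ] V}
    (hA : ∀ u v, G (y, s) (A u) v = (1 / 2 : ℝ) * fderiv ℝ G (y, s) (0, 1) u v) (u v : V × ℝ) :
    (christoffel (normalMetric G) (y, s) u v).1
      = christoffel (fun z ↦ G (z, s)) y u.1 v.1 + u.2 • A v.1 + v.2 • A u.1 := by
  refine ext_of_pos hpos fun w ↦ ?_
  have h := koszul (normalMetric G) (y, s) (normalMetric_pos hpos) u v (w, 0)
  have h' := koszul (fun z ↦ G (z, s)) y hpos u.1 v.1 w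
  simp only [(hasFDerivAt_slice hG).fderiv, ContinuousLinearMap.comp_apply,
    ContinuousLinearMap.inl_apply] at h'
  -- The horizontal part reproduces the Koszul formula of the slice; the vertical part is `∂_t G`,
  -- which `hA` converts into `A`.
  have hsplit : ∀ z : V × ℝ, fderiv ℝ G (y, s) z
      = fderiv ℝ G (y, s) (z.1, 0) + z.2 • fderiv ℝ G (y, s) (0, 1) := fun z ↦ by
    rw [← map_smul, ← map_add]
    simp
  simp only [fderiv_normalMetric_apply hG, normalMetric_apply] at h
  rw [hsplit u, hsplit v] at h
  simp only [map_add, map_smul, add_apply, smul_apply, smul_eq_mul, hA, h', mul_zero,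
    add_zero] at h ⊢
  linarith

/-- The shape operator drops out on tangent vectors, so any choice serves; here it is built from the
inverse of `G`. The identity thus holds at all nearby points and can be differentiated, even where a
shape operator is prescribed at one point only. -/
theorem christoffel_slice (hG : DifferentiableAt ℝ G (y, s))
    (hpos : ∀ v, v ≠ 0 → 0 < G (y, s) v v) (u v : V) :
    christoffel (fun z ↦ G (z, s)) y u v = (christoffel (normalMetric G) (y, s) (u, 0) (v, 0)).1 := by
  obtain ⟨e, he⟩ := exists_equiv_of_pos _ hpos
  have hA : ∀ u v, G (y, s) ((e.symm.toContinuousLinearMap ∘L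
      ((1 / 2 : ℝ) • fderiv ℝ G (y, s) (0, 1))) u) v
        = (1 / 2 : ℝ) * fderiv ℝ G (y, s) (0, 1) u v := fun u v ↦ by
    rw [← he]
    simp
  rw [christoffel_normalMetric_fst hG hpos hA]
  simp

/-- The Ricci tensor of `G_t + dt ⊗ dt` on vectors tangent to a slice, in terms of the Ricci tensor
of the slice and its second fundamental form `∂_t G / 2`, whose shape operator is `A`. -/
theorem ricci_normalMetric (hG : ContDiffAt ℝ 2 G (y, s))
    (hpos : ∀ᶠ q in 𝓝 (y, s), ∀ v, v ≠ 0 → 0 < G q v v) {A : V →L[ℝ] V}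
    (hA : ∀ u v, G (y, s) (A u) v = (1 / 2 : ℝ) * fderiv ℝ G (y, s) (0, 1) u v) (v w : V) :
    ricci (normalMetric G) (y, s) (v, 0) (w, 0)
      = ricci (fun z ↦ G (z, s)) y v w
        - LinearMap.trace ℝ V A * ((1 / 2 : ℝ) * fderiv ℝ G (y, s) (0, 1) v w)
        + (1 / 2 : ℝ) * fderiv ℝ G (y, s) (0, 1) (A v) w
        + (1 / 2 : ℝ) * fderiv ℝ G (y, s) (0, 1) v (A w)
        - (1 / 2 : ℝ) * fderiv ℝ (fun q ↦ fderiv ℝ G q (0, 1)) (y, s) (0, 1) v w := by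
  have hdiff : ∀ᶠ q in 𝓝 (y, s), DifferentiableAt ℝ G q := by
    filter_upwards [hG.eventually (by norm_num)] with q hq using hq.differentiableAt (by norm_num)
  have hΓ : DifferentiableAt ℝ (christoffel (normalMetric G)) (y, s) :=
    differentiableAt_christoffel (contDiffAt_normalMetric hG) (normalMetric_pos hpos.self_of_nhds)
  have hd := hdiff.self_of_nhds
  have hp := hpos.self_of_nhds
  have hΓe := hasFDerivAt_apply₂ hΓ
  -- the tangential part is the connection of the slice
  have hslice : ∀ u a b : V, fderiv ℝ (christoffel fun z ↦ G (z, s)) y u a b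
      = (fderiv ℝ (christoffel (normalMetric G)) (y, s) (u, 0) (a, 0) (b, 0)).1 := by
    have hG' : ContDiffAt ℝ 2 (fun z ↦ G (z, s)) y :=
      hG.comp y (contDiffAt_id.prodMk contDiffAt_const)
    have hΓ' := differentiableAt_christoffel hG' hp
    intro u a b
    have h1 := hasFDerivAt_apply₂ hΓ' a b
    have h2 := ((ContinuousLinearMap.fst ℝ V ℝ).hasFDerivAt.comp y
      ((hΓe (a, 0) (b, 0)).comp y (hasFDerivAt_prodMk_left y s)))
    have hev : (fun z ↦ christoffel (fun z ↦ G (z, s)) z a b) =ᶠ[𝓝 y]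
        fun z ↦ (christoffel (normalMetric G) (z, s) (a, 0) (b, 0)).1 := by
      have hc : Filter.Tendsto (fun z : V ↦ (z, s)) (𝓝 y) (𝓝 (y, s)) :=
        Continuous.tendsto (by fun_prop) y
      filter_upwards [hc.eventually hdiff, hc.eventually hpos] with z hz1 hz2
        using christoffel_slice hz1 hz2 a b
    exact congrArg (fun L : V →L[ℝ] V ↦ L u) (h1.unique (h2.congr_of_eventuallyEq hev))
  have hsnd : ∀ a b c : V × ℝ, (fderiv ℝ (christoffel (normalMetric G)) (y, s) a b c).2
      = -((1 / 2 : ℝ) * fderiv ℝ (fun q ↦ fderiv ℝ G q (0, 1)) (y, s) a b.1 c.1) := by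
    intro a b c
    have h1 := (ContinuousLinearMap.snd ℝ V ℝ).hasFDerivAt.comp (y, s) (hΓe b c)
    have hD : DifferentiableAt ℝ (fun q ↦ fderiv ℝ G q (0, 1)) (y, s) :=
      ((hG.fderiv_right (m := 1) (by norm_num)).differentiableAt (by norm_num)).clm_apply
        (differentiableAt_const _)
    have h2 := (((hD.hasFDerivAt.clm_apply (hasFDerivAt_const b.1 _)).clm_apply
      (hasFDerivAt_const c.1 _)).const_mul (1 / 2 : ℝ)).neg
    have hev : (fun q ↦ (christoffel (normalMetric G) q b c).2) =ᶠ[𝓝 (y, s)]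
        fun q ↦ -((1 / 2 : ℝ) * fderiv ℝ G q (0, 1) b.1 c.1) := by
      filter_upwards [hdiff, hpos] with q hq1 hq2
        using christoffel_normalMetric_snd (y := q.1) (s := q.2) hq1 hq2 b c
    have h3 := congrArg (fun L : V × ℝ →L[ℝ] ℝ ↦ L a) (h1.unique (h2.congr_of_eventuallyEq hev))
    simpa using h3
  have hfst := christoffel_normalMetric_fst hd hp hA
  have hsnd0 := christoffel_normalMetric_snd hd hp
  -- The Gauss equation. The corrections arise when the normal component `-½ ∂_t G` of one
  -- Christoffel symbol is fed into another, whose tangential part then contributes `A`.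
  have htan : LinearMap.fst ℝ V ℝ ∘ₗ (curvature (normalMetric G) (y, s) (v, 0) (w, 0) :
        V × ℝ →ₗ[ℝ] V × ℝ) ∘ₗ LinearMap.inl ℝ V ℝ
      = (curvature (fun z ↦ G (z, s)) y v w : V →ₗ[ℝ] V)
        - ((1 / 2 : ℝ) * fderiv ℝ G (y, s) (0, 1) v w) • (A : V →ₗ[ℝ] V)
        + ((1 / 2 : ℝ) • (((fderiv ℝ G (y, s) (0, 1)).flip w : V →L[ℝ] ℝ) : V →ₗ[ℝ] ℝ)).smulRight
          (A v) := by
    ext u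
    simp only [LinearMap.comp_apply, LinearMap.fst_apply, LinearMap.inl_apply,
      ContinuousLinearMap.coe_coe, curvature_apply, Prod.fst_add, Prod.fst_sub, hfst, hsnd0,
      LinearMap.add_apply, LinearMap.sub_apply, LinearMap.smul_apply, LinearMap.smulRight_apply,
      ContinuousLinearMap.flip_apply, hslice, smul_eq_mul, zero_smul, add_zero]
    module
  -- The rank-one term of `htan` has trace `½ ∂_t G(Av, w)`. The remaining diagonal entry, in the
  -- direction `∂_t`, is the Riccati part `½ ∂_t G(v, Aw) - ½ ∂_t² G(v, w)`.
  rw [ricci, LinearMap.trace_prod_real, htan, ContinuousLinearMap.coe_coe, curvature_apply]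
  simp only [map_add, map_sub, map_smul, LinearMap.trace_smulRight, Prod.snd_add, Prod.snd_sub,
    hsnd, hsnd0, hfst, map_zero, ricci, zero_apply, smul_eq_mul, LinearMap.smul_apply,
    ContinuousLinearMap.coe_coe, ContinuousLinearMap.flip_apply, zero_smul, one_smul, add_zero,
    zero_add]
  ring

end Normal

end Coord

/-! ### The family `e^(2t) g + e^(2t) (e^(2t) - 1) η ⊗ η` -/

namespace Coord

variable {V : Type*} [NormedAddCommGroup V] [NormedSpace ℝ V]

/-- The Ricci tensor at a point depends only on the germ of the metric there. -/
theorem ricci_congr {G G' : V → V →L[ℝ] V →L[ℝ] ℝ} {y : V} (h : G =ᶠ[𝓝 y] G') (v w : V) :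
    ricci G y v w = ricci G' y v w := by
  have hΓ : christoffel G =ᶠ[𝓝 y] christoffel G' := by
    filter_upwards [h.eventuallyEq_nhds] with z hz
    rw [christoffel, christoffel, christoffelFirst, christoffelFirst, hz.fderiv_eq, hz.eq_of_nhds]
  rw [ricci, ricci, curvature, curvature, hΓ.fderiv_eq, hΓ.eq_of_nhds]

theorem fderiv_smul_add_smul_vertical {F : Type*} [NormedAddCommGroup F] [NormedSpace ℝ F]
    {α β : ℝ → ℝ} {α' β' : ℝ} {g h : V → F} {y : V} {s : ℝ} (hα : HasDerivAt α α' s)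
    (hβ : HasDerivAt β β' s) (hg : DifferentiableAt ℝ g y) (hh : DifferentiableAt ℝ h y) :
    fderiv ℝ (fun q : V × ℝ ↦ α q.2 • g q.1 + β q.2 • h q.1) (y, s) (0, 1)
      = α' • g y + β' • h y := by
  have hd : DifferentiableAt ℝ (fun q : V × ℝ ↦ α q.2 • g q.1 + β q.2 • h q.1) (y, s) :=
    ((hα.differentiableAt.comp (y, s) differentiableAt_snd).smul
      (hg.comp (y, s) differentiableAt_fst)).add
    ((hβ.differentiableAt.comp (y, s) differentiableAt_snd).smul
      (hh.comp (y, s) differentiableAt_fst))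
  have h1 := (hd.hasFDerivAt.comp s (hasFDerivAt_prodMk_right y s)).hasDerivAt
  have h2 := (hα.smul_const (g y)).add (hβ.smul_const (h y))
  exact h1.unique h2

theorem hasDerivAt_exp_two_mul (s : ℝ) :
    HasDerivAt (fun s ↦ Real.exp (2 * s)) (2 * Real.exp (2 * s)) s := by
  have := ((hasDerivAt_id s).const_mul 2).exp
  simpa [mul_comm] using this

/-- The family of tensors `e^(2t) g + e^(2t) (e^(2t) - 1) h` over `V × ℝ`. -/
noncomputable def expFamily {F : Type*} [NormedAddCommGroup F] [NormedSpace ℝ F] (g h : V → F)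
    (q : V × ℝ) : F :=
  Real.exp (2 * q.2) • g q.1 + (Real.exp (2 * q.2) * (Real.exp (2 * q.2) - 1)) • h q.1

section ExpFamily

variable {F : Type*} [NormedAddCommGroup F] [NormedSpace ℝ F] {g h : V → F} {y : V}

theorem contDiffAt_expFamily {m : WithTop ℕ∞} (hg : ContDiffAt ℝ m g y) (hh : ContDiffAt ℝ m h y)
    (t : ℝ) : ContDiffAt ℝ m (expFamily g h) (y, t) := by
  unfold expFamily
  have hg' : ContDiffAt ℝ m (fun q : V × ℝ ↦ g q.1) (y, t) := hg.comp (y, t) contDiffAt_fst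
  have hh' : ContDiffAt ℝ m (fun q : V × ℝ ↦ h q.1) (y, t) := hh.comp (y, t) contDiffAt_fst
  have he : ContDiffAt ℝ m (fun q : V × ℝ ↦ Real.exp (2 * q.2)) (y, t) := by fun_prop
  exact (he.smul hg').add ((he.mul (he.sub contDiffAt_const)).smul hh')

theorem fderiv_expFamily_vertical {q : V × ℝ} (hg : DifferentiableAt ℝ g q.1)
    (hh : DifferentiableAt ℝ h q.1) :
    fderiv ℝ (expFamily g h) q (0, 1) = (2 * Real.exp (2 * q.2)) • g q.1
      + (4 * (Real.exp (2 * q.2) * Real.exp (2 * q.2)) - 2 * Real.exp (2 * q.2)) • h q.1 := by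
  unfold expFamily
  obtain ⟨y, s⟩ := q
  have hα := hasDerivAt_exp_two_mul s
  have hβ : HasDerivAt (fun s ↦ Real.exp (2 * s) * (Real.exp (2 * s) - 1))
      (4 * (Real.exp (2 * s) * Real.exp (2 * s)) - 2 * Real.exp (2 * s)) s :=
    (hα.mul (hα.sub_const 1)).congr_deriv (by ring)
  exact fderiv_smul_add_smul_vertical hα hβ hg hh

/-- The first derivative has the same shape, with new coefficients in `t`, so the same product rule
applies again. Being `C¹` at `y` gives differentiability nearby, which makes the first formula valid
on a neighbourhood. -/
theorem fderiv_fderiv_expFamily_vertical (hg : ContDiffAt ℝ 1 g y) (hh : ContDiffAt ℝ 1 h y)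
    (t : ℝ) :
    fderiv ℝ (fun q ↦ fderiv ℝ (expFamily g h) q (0, 1)) (y, t) (0, 1)
      = (4 * Real.exp (2 * t)) • g y
        + (16 * (Real.exp (2 * t) * Real.exp (2 * t)) - 4 * Real.exp (2 * t)) • h y := by
  have hd : ∀ᶠ z in 𝓝 y, DifferentiableAt ℝ g z ∧ DifferentiableAt ℝ h z := by
    filter_upwards [hg.eventually (by norm_num), hh.eventually (by norm_num)] with z h1 h2
      using ⟨h1.differentiableAt (by norm_num), h2.differentiableAt (by norm_num)⟩
  have hfst : Filter.Tendsto (Prod.fst : V × ℝ → V) (𝓝 (y, t)) (𝓝 y) :=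
    continuous_fst.tendsto (y, t)
  have hev : (fun q ↦ fderiv ℝ (expFamily g h) q (0, 1)) =ᶠ[𝓝 (y, t)] fun q : V × ℝ ↦
      (2 * Real.exp (2 * q.2)) • g q.1
        + (4 * (Real.exp (2 * q.2) * Real.exp (2 * q.2)) - 2 * Real.exp (2 * q.2)) • h q.1 := by
    filter_upwards [hfst.eventually hd] with q hq using fderiv_expFamily_vertical hq.1 hq.2
  have hα := hasDerivAt_exp_two_mul t
  have hα' : HasDerivAt (fun s ↦ 2 * Real.exp (2 * s)) (4 * Real.exp (2 * t)) t :=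
    (hα.const_mul 2).congr_deriv (by ring)
  have hβ : HasDerivAt
      (fun s ↦ 4 * (Real.exp (2 * s) * Real.exp (2 * s)) - 2 * Real.exp (2 * s))
      (16 * (Real.exp (2 * t) * Real.exp (2 * t)) - 4 * Real.exp (2 * t)) t :=
    (((hα.mul hα).const_mul 4).sub (hα.const_mul 2)).congr_deriv (by ring)
  rw [hev.fderiv_eq]
  exact fderiv_smul_add_smul_vertical hα' hβ (hg.differentiableAt (by norm_num))
    (hh.differentiableAt (by norm_num))

end ExpFamily

/-- The Ricci tensors of `G_t + dt ⊗ dt` and of `G_t = e^(2t) g + e^(2t) (e^(2t) - 1) η ⊗ η`, where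
`η` is the `g`-dual of a unit vector `ξ`. -/
theorem ricci_normalMetric_expFamily [FiniteDimensional ℝ V] {g h : V → V →L[ℝ] V →L[ℝ] ℝ} {y : V}
    (hg : ContDiffAt ℝ 2 g y) (hh : ContDiffAt ℝ 2 h y) {t : ℝ}
    (hpos : ∀ᶠ q in 𝓝 (y, t), ∀ v, v ≠ 0 → 0 < expFamily g h q v v)
    (hsymm : ∀ u v, g y u v = g y v u) {η : V →L[ℝ] ℝ} {ξ : V}
    (hη : ∀ u v, h y u v = η u * η v) (hgξ : ∀ u, g y u ξ = η u) (hξ : η ξ = 1) (u v : V) :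
    ricci (fun z ↦ expFamily g h (z, t)) y u v
      = ricci (normalMetric (expFamily g h)) (y, t) (u, 0) (v, 0)
        + (Module.finrank ℝ V + 1) * expFamily g h (y, t) u v
        + (Module.finrank ℝ V + 1)
          * (Real.exp (2 * t) * η u * (Real.exp (2 * t) * η v)) := by
  have hG : ∀ a b, expFamily g h (y, t) a b = Real.exp (2 * t) * g y a b
      + Real.exp (2 * t) * (Real.exp (2 * t) - 1) * (η a * η b) := fun a b ↦ by
    simp [expFamily, hη]
  have hD : ∀ a b, fderiv ℝ (expFamily g h) (y, t) (0, 1) a b = 2 * Real.exp (2 * t) * g y a b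
      + (4 * (Real.exp (2 * t) * Real.exp (2 * t)) - 2 * Real.exp (2 * t)) * (η a * η b) :=
    fun a b ↦ by
      rw [fderiv_expFamily_vertical (hg.differentiableAt (by norm_num))
        (hh.differentiableAt (by norm_num))]
      simp [hη]
  have hD2 : ∀ a b, fderiv ℝ (fun q ↦ fderiv ℝ (expFamily g h) q (0, 1)) (y, t) (0, 1) a b
      = 4 * Real.exp (2 * t) * g y a b
        + (16 * (Real.exp (2 * t) * Real.exp (2 * t)) - 4 * Real.exp (2 * t)) * (η a * η b) :=
    fun a b ↦ by
      rw [fderiv_fderiv_expFamily_vertical (hg.of_le (by norm_num)) (hh.of_le (by norm_num))]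
      simp [hη]
  -- Since `g_t(ξ, ·) = e^(4t) η`, one has `g_t(Aa, b) = g_t(a, b) + η_t(a) η_t(b)`, which is `½ ∂_t
  -- g_t(a, b)`.
  let A : V →L[ℝ] V := ContinuousLinearMap.id ℝ V + η.smulRight ξ
  have hA : ∀ a, A a = a + η a • ξ := fun a ↦ rfl
  have hηA : ∀ a, η (A a) = 2 * η a := fun a ↦ by
    rw [hA, map_add, map_smul, hξ, smul_eq_mul]
    ring
  have hgA' : ∀ a b, g y b (A a) = g y b a + η a * η b := fun a b ↦ by
    rw [hA, map_add, map_smul, hgξ, smul_eq_mul]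
  have hgA : ∀ a b, g y (A a) b = g y a b + η a * η b := fun a b ↦ by
    rw [hsymm, hgA', hsymm]
  have htr : LinearMap.trace ℝ V A = Module.finrank ℝ V + 1 := by
    have h1 : (A : V →ₗ[ℝ] V) = LinearMap.id + (η : V →ₗ[ℝ] ℝ).smulRight ξ := rfl
    rw [h1, map_add, LinearMap.trace_smulRight, LinearMap.trace_id, ContinuousLinearMap.coe_coe, hξ]
  have hshape : ∀ a b, expFamily g h (y, t) (A a) b
      = (1 / 2 : ℝ) * fderiv ℝ (expFamily g h) (y, t) (0, 1) a b := fun a b ↦ by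
    rw [hD, hG, hgA, hηA]
    ring
  -- The two terms with `A` add up to `2 e^(2t) g + (8 e^(4t) - 2 e^(2t)) η ⊗ η`, exactly `½ ∂_t²
  -- G`, so only the trace term survives.
  rw [ricci_normalMetric (contDiffAt_expFamily hg hh t) hpos hshape, htr, hD, hD, hD, hD2, hG, hgA,
    hgA', hηA, hηA]
  ring

end Coord

/-! ### Tensors in preferred charts: regularity, values at the centre, products with `ℝ` -/

section Manifold

variable {E : Type*} [NormedAddCommGroup E] [NormedSpace ℝ E]
  {H : Type*} [TopologicalSpace H] {I : ModelWithCorners ℝ E H}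
  {M : Type*} [TopologicalSpace M] [ChartedSpace H M]

theorem mem_chart_source_of_mem_target {x : M} {y : E} (hy : y ∈ (extChartAt I x).target) :
    (extChartAt I x).symm y ∈ (chartAt H x).source := by
  rw [← extChartAt_source I]
  exact (extChartAt I x).map_target hy

/-- Smoothness of sections is expressed through trivializations of the tangent bundle; this links
them to derivatives of charts. -/
theorem chartFrame_eq_symmL [I.Boundaryless] [IsManifold I ∞ M] {x : M} {y : E}
    (hy : y ∈ (extChartAt I x).target) :
    chartFrame I x y = (trivializationAt E (TangentSpace I) x).symmL ℝ ((extChartAt I x).symm y) := by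
  have : IsManifold I 1 M := IsManifold.of_le (n := ∞) (by norm_num)
  -- The types of these derivatives depend on the base point. Read as endomorphisms of `E`, they can
  -- be compared by substitution.
  have key : ∀ z, z = y → (mfderiv 𝓘(ℝ, E) I (extChartAt I x).symm z : E →L[ℝ] E)
      = (mfderiv 𝓘(ℝ, E) I (extChartAt I x).symm y : E →L[ℝ] E) := by
    rintro _ rfl
    rfl
  rw [TangentBundle.symmL_trivializationAt (mem_chart_source_of_mem_target hy),
    ModelWithCorners.Boundaryless.range_eq_univ, mfderivWithin_univ]
  exact (key _ ((extChartAt I x).right_inv hy)).symm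

theorem chartFrame_injective [I.Boundaryless] [IsManifold I ∞ M] {x : M} {y : E}
    (hy : y ∈ (extChartAt I x).target) : Function.Injective (chartFrame I x y) := by
  have : IsManifold I 1 M := IsManifold.of_le (n := ∞) (by norm_num)
  rw [chartFrame_eq_symmL hy]
  have hb : (extChartAt I x).symm y ∈ (trivializationAt E (TangentSpace I) x).baseSet :=
    mem_chart_source_of_mem_target hy
  exact Function.LeftInverse.injective
    ((trivializationAt E (TangentSpace I) x).continuousLinearMapAt_symmL hb)

/-- `T_x M` is identified with `E` by the preferred chart at `x` itself, so the frame at the centre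
is the coordinate change from that chart to itself. -/
theorem chartFrame_self [I.Boundaryless] [IsManifold I ∞ M] (x : M) :
    (chartFrame I x (extChartAt I x x) : E →L[ℝ] E) = ContinuousLinearMap.id ℝ E := by
  have : IsManifold I 1 M := IsManifold.of_le (n := ∞) (by norm_num)
  have key : ∀ p, p = x → ((trivializationAt E (TangentSpace I) x).symmL ℝ p : E →L[ℝ] E)
      = ((trivializationAt E (TangentSpace I) x).symmL ℝ x : E →L[ℝ] E) := by
    rintro _ rfl
    rfl
  refine (chartFrame_eq_symmL (mem_extChartAt_target x)).trans ((key _ (extChartAt_to_inv x)).trans ?_)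
  rw [TangentBundle.symmL_trivializationAt_eq_core (mem_chart_source H x)]
  ext v
  exact (tangentBundleCore I M).coordChange_self (achart H x) x (mem_chart_source H x) v

theorem tensorInChart_self [I.Boundaryless] [IsManifold I ∞ M]
    (g : (p : M) → TangentSpace I p →L[ℝ] TangentSpace I p →L[ℝ] ℝ) (x : M)
    (u v : TangentSpace I x) : tensorInChart I g x (extChartAt I x x) u v = g x u v := by
  have key : ∀ p, p = x → (g p : E →L[ℝ] E →L[ℝ] ℝ) u v = (g x : E →L[ℝ] E →L[ℝ] ℝ) u v := by
    rintro _ rfl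
    rfl
  have h : ∀ w : E, (chartFrame I x (extChartAt I x x) : E →L[ℝ] E) w = w := fun w ↦ by
    rw [chartFrame_self]
    rfl
  have h0 : tensorInChart I g x (extChartAt I x x) u v
      = (g ((extChartAt I x).symm (extChartAt I x x)) : E →L[ℝ] E →L[ℝ] ℝ)
        ((chartFrame I x (extChartAt I x x) : E →L[ℝ] E) u)
        ((chartFrame I x (extChartAt I x x) : E →L[ℝ] E) v) := rfl
  rw [h0, h u, h v]
  exact key _ (extChartAt_to_inv x)

theorem tensorInChart_pos [I.Boundaryless] [IsManifold I ∞ M]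
    {g : (p : M) → TangentSpace I p →L[ℝ] TangentSpace I p →L[ℝ] ℝ}
    (hg : ∀ p v, v ≠ 0 → 0 < g p v v) {x : M} {y : E} (hy : y ∈ (extChartAt I x).target) (v : E)
    (hv : v ≠ 0) : 0 < tensorInChart I g x y v v := by
  rw [tensorInChart_apply]
  refine hg _ _ fun h ↦ hv (chartFrame_injective hy ?_)
  rw [h, map_zero]

theorem contDiffAt_tensorInChart [I.Boundaryless] [IsManifold I ∞ M]
    {g : (p : M) → TangentSpace I p →L[ℝ] TangentSpace I p →L[ℝ] ℝ}
    (hg : ContMDiff I (I.prod 𝓘(ℝ, E →L[ℝ] E →L[ℝ] ℝ)) ∞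
      (fun p ↦ TotalSpace.mk' (E →L[ℝ] E →L[ℝ] ℝ)
        (E := fun q : M ↦ (TangentSpace I q →L[ℝ] TangentSpace I q →L[ℝ] Bundle.Trivial M ℝ q)) p
        (g p))) (x : M) :
    ContDiffAt ℝ ∞ (tensorInChart I g x) (extChartAt I x x) := by
  have ht := extChartAt_target_mem_nhds (I := I) x
  have h := ((contMDiffAt_hom_bundle _).1 (hg x)).2
  have hs : ContMDiffAt 𝓘(ℝ, E) I ∞ (extChartAt I x).symm (extChartAt I x x) :=
    (contMDiffOn_extChartAt_symm x).contMDiffAt ht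
  rw [← extChartAt_to_inv (I := I) x] at h
  have hc := h.comp (extChartAt I x x) hs
  rw [extChartAt_to_inv] at hc
  refine (hc.congr_of_eventuallyEq ?_).contDiffAt
  filter_upwards [ht] with y hy
  have hb : (extChartAt I x).symm y ∈ (trivializationAt E (TangentSpace I) x).baseSet :=
    mem_chart_source_of_mem_target hy
  ext u v
  have h3 := inCoordinates_apply_eq₂ (F₁ := E) (F₂ := E) (F₃ := ℝ) (E₁ := TangentSpace I)
    (E₂ := TangentSpace I) (E₃ := Bundle.Trivial M ℝ) (ϕ := g ((extChartAt I x).symm y))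
    (v := u) (w := v) hb hb (Set.mem_univ _)
  refine Eq.trans ?_ h3.symm
  rw [tensorInChart_apply, chartFrame_eq_symmL hy, Trivialization.symmL_apply _ hb,
    Trivialization.symmL_apply _ hb]
  simp

/-- The preferred chart of the product is the product of the chart at `x` with the identity of `ℝ`.
-/
theorem chartFrame_prod_real [I.Boundaryless] [IsManifold I ∞ M] {x : M} (t : ℝ) {y : E} (s : ℝ)
    (hy : y ∈ (extChartAt I x).target) :
    (chartFrame (I.prod 𝓘(ℝ, ℝ)) (x, t) (y, s) : E × ℝ →L[ℝ] E × ℝ)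
      = (chartFrame I x y : E →L[ℝ] E).prodMap (ContinuousLinearMap.id ℝ ℝ) := by
  have : IsManifold I 1 M := IsManifold.of_le (n := ∞) (by norm_num)
  have hd : MDifferentiableAt 𝓘(ℝ, E) I (extChartAt I x).symm y :=
    (mdifferentiableOn_extChartAt_symm y hy).mdifferentiableAt
      ((isOpen_extChartAt_target x).mem_nhds hy)
  have h := mfderiv_prodMap (p := (y, s)) hd (mdifferentiableAt_id (I := 𝓘(ℝ, ℝ)) (x := s))
  rw [mfderiv_id] at h
  have he : ((extChartAt (I.prod 𝓘(ℝ, ℝ)) (x, t)).symm : E × ℝ → M × ℝ)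
      = Prod.map (extChartAt I x).symm id := by
    rw [extChartAt_prod]
    rfl
  rw [← modelWithCornersSelf_prod, ← he, chartedSpaceSelf_prod] at h
  exact h

end Manifold

/-! ### From coordinates to the slices and the symplectization -/

namespace ContactMetricStructure

variable {E : Type*} [NormedAddCommGroup E] [NormedSpace ℝ E]
  {H : Type*} [TopologicalSpace H] {I : ModelWithCorners ℝ E H}
  {M : Type*} [TopologicalSpace M] [ChartedSpace H M] [IsManifold I ∞ M] {n : ℕ}

theorem slice_zero_metric (S : ContactMetricStructure I M n) :
    (S.slice 0).metric.inner = S.metric.inner := by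
  funext p
  ext u v
  rw [slice_metric]
  simp

/-- The metrics of the slices in the preferred chart at `x`. -/
theorem tensorInChart_slice (S : ContactMetricStructure I M n) (x : M) (q : E × ℝ) :
    tensorInChart I (S.slice q.2).metric.inner x q.1
      = Coord.expFamily (tensorInChart I S.metric.inner x) (tensorInChart I S.formSq x) q :=
  rfl

/-- The product chart has a block-diagonal derivative over the chart target, so the coordinate
expression keeps the form `G_t + dt²` there. Agreement of germs suffices, by `Coord.ricci_congr`. -/
theorem tensorInChart_symplectizationMetric [I.Boundaryless] (S : ContactMetricStructure I M n)
    (x : M) (t : ℝ) :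
    tensorInChart (I.prod 𝓘(ℝ, ℝ)) S.symplectizationMetric (x, t)
      =ᶠ[𝓝 (extChartAt I x x, t)] Coord.normalMetric
        (Coord.expFamily (tensorInChart I S.metric.inner x) (tensorInChart I S.formSq x)) := by
  have ht : ∀ᶠ q : E × ℝ in 𝓝 (extChartAt I x x, t), q.1 ∈ (extChartAt I x).target :=
    continuous_fst.continuousAt.eventually (extChartAt_target_mem_nhds x)
  filter_upwards [ht] with q hq
  obtain ⟨y, s⟩ := q
  refine ContinuousLinearMap.ext fun u ↦ ContinuousLinearMap.ext fun v ↦ ?_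
  have h1 : ∀ w : E × ℝ, (chartFrame (I.prod 𝓘(ℝ, ℝ)) (x, t) (y, s) : E × ℝ →L[ℝ] E × ℝ) w
      = ((chartFrame I x y : E →L[ℝ] E) w.1, w.2) := fun w ↦ by
    rw [chartFrame_prod_real t s hq]
    rfl
  have h2 : tensorInChart (I.prod 𝓘(ℝ, ℝ)) S.symplectizationMetric (x, t) (y, s) u v
      = (S.symplectizationMetric ((extChartAt I x).symm y, s) : E × ℝ →L[ℝ] E × ℝ →L[ℝ] ℝ)
        ((chartFrame (I.prod 𝓘(ℝ, ℝ)) (x, t) (y, s) : E × ℝ →L[ℝ] E × ℝ) u)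
        ((chartFrame (I.prod 𝓘(ℝ, ℝ)) (x, t) (y, s) : E × ℝ →L[ℝ] E × ℝ) v) := by
    rw [tensorInChart_apply, extChartAt_prod]
    rfl
  rw [h2, h1, h1, Coord.normalMetric_apply]
  exact S.symplectizationMetric_apply _ s _ _ _ _

/-- The Ricci tensors of a slice and of the metric symplectization. -/
theorem ricciTensor_slice [FiniteDimensional ℝ E] [I.Boundaryless]
    (hn : Module.finrank ℝ E = 2 * n + 1) (S : ContactMetricStructure I M n) (x : M) (t : ℝ)
    (u v : TangentSpace I x) :
    ricciTensor I (S.slice t).metric.inner x u v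
      = ricciTensor (I.prod 𝓘(ℝ, ℝ)) S.symplectizationMetric (x, t) (u, 0) (v, 0)
        + (2 * n + 2) * (S.slice t).metric.inner x u v
        + (2 * n + 2) * ((S.slice t).form x u * (S.slice t).form x v) := by
  have hpos : ∀ᶠ q : E × ℝ in 𝓝 (extChartAt I x x, t), ∀ w, w ≠ 0 → 0 < Coord.expFamily
      (tensorInChart I S.metric.inner x) (tensorInChart I S.formSq x) q w w := by
    have ht : ∀ᶠ q : E × ℝ in 𝓝 (extChartAt I x x, t), q.1 ∈ (extChartAt I x).target :=
      continuous_fst.continuousAt.eventually (extChartAt_target_mem_nhds x)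
    filter_upwards [ht] with q hq w hw
    rw [← tensorInChart_slice]
    exact tensorInChart_pos (S.slice q.2).metric.pos hq w hw
  have hsymm : ∀ a b : E, tensorInChart I S.metric.inner x (extChartAt I x x) a b
      = tensorInChart I S.metric.inner x (extChartAt I x x) b a :=
    fun a b ↦ S.metric.symm _ _ _
  have key := Coord.ricci_normalMetric_expFamily
    ((contDiffAt_tensorInChart S.metric.contMDiff x).of_le (m := 2) (by norm_cast))
    ((contDiffAt_tensorInChart S.smooth_formSq x).of_le (m := 2) (by norm_cast)) hpos hsymm
    (η := S.form x) (ξ := S.reeb x)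
    (fun a b ↦ (tensorInChart_self S.formSq x a b).trans (S.formSq_apply x a b))
    (fun a ↦ (tensorInChart_self S.metric.inner x a (S.reeb x)).trans (S.metric_reeb x a))
    (S.form_reeb x) u v
  have hbar : ricciTensor (I.prod 𝓘(ℝ, ℝ)) S.symplectizationMetric (x, t) (u, 0) (v, 0)
      = Coord.ricci (Coord.normalMetric (Coord.expFamily (tensorInChart I S.metric.inner x)
        (tensorInChart I S.formSq x))) (extChartAt I x x, t) (u, 0) (v, 0) :=
    Coord.ricci_congr (S.tensorInChart_symplectizationMetric x t) _ _
  have hslice : Coord.expFamily (tensorInChart I S.metric.inner x) (tensorInChart I S.formSq x)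
      (extChartAt I x x, t) u v = (S.slice t).metric.inner x u v :=
    tensorInChart_self (S.slice t).metric.inner x u v
  -- The constant of the theorem is `tr A = dim M + 1`.
  have hdim : (Module.finrank ℝ E + 1 : ℝ) = 2 * n + 2 := by
    rw [hn]
    push_cast
    ring
  rw [hdim, hslice] at key
  exact key.trans (by rw [hbar]; rfl)

end ContactMetricStructure

theorem proposition4p4
    {E : Type*} [NormedAddCommGroup E] [NormedSpace ℝ E] [FiniteDimensional ℝ E]
    {H : Type*} [TopologicalSpace H] (I : ModelWithCorners ℝ E H) [I.Boundaryless]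
    {M : Type*} [TopologicalSpace M] [ChartedSpace H M] [IsManifold I ∞ M]
    [T2Space M] [SecondCountableTopology M]
    (n : ℕ) (hn : Module.finrank ℝ E = 2 * n + 1)
    (S : ContactMetricStructure I M n) :
    -- the curvature condition makes every slice, and `M` itself, `η`-Einstein
    ((∀ (q : M × ℝ) (X Y : TangentSpace (I.prod 𝓘(ℝ, ℝ)) q),
        ricciTensor (I.prod 𝓘(ℝ, ℝ)) S.symplectizationMetric q X Y
          = (-2 * n - 4) * (ContactMetricStructure.dt I q X * ContactMetricStructure.dt I q Y)) →
      (∀ t : ℝ, (S.slice t).IsEtaEinstein ∧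
        ∀ (x : M) (u v : TangentSpace I x),
          ricciTensor I (S.slice t).metric.inner x u v
            = (2 * n + 2) * (S.slice t).metric.inner x u v
              + (2 * n + 2) * ((S.slice t).form x u * (S.slice t).form x v)) ∧
      S.IsEtaEinstein) ∧
    -- without the curvature condition, the same constants relate the two Ricci tensors
    (∀ (t : ℝ) (x : M) (u v : TangentSpace I x),
      ricciTensor I (S.slice t).metric.inner x u v
        = ricciTensor (I.prod 𝓘(ℝ, ℝ)) S.symplectizationMetric (x, t)
            (mfderiv I (I.prod 𝓘(ℝ, ℝ)) (fun p : M ↦ (p, t)) x u)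
            (mfderiv I (I.prod 𝓘(ℝ, ℝ)) (fun p : M ↦ (p, t)) x v)
          + (2 * n + 2) * (S.slice t).metric.inner x u v
          + (2 * n + 2) * ((S.slice t).form x u * (S.slice t).form x v)) := by
  refine ⟨fun hRic ↦ ?_, fun t x u v ↦ ?_⟩
  · have hslice : ∀ (t : ℝ) (x : M) (u v : TangentSpace I x),
        ricciTensor I (S.slice t).metric.inner x u v
          = (2 * n + 2) * (S.slice t).metric.inner x u v
            + (2 * n + 2) * ((S.slice t).form x u * (S.slice t).form x v) := fun t x u v ↦ by
      -- Vectors tangent to a slice are killed by `dt`, so the hypothesis gives zero on them.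
      have h0 : ∀ w : E, ContactMetricStructure.dt I (x, t) (w, (0 : ℝ)) = 0 := fun w ↦ by
        have h : ContactMetricStructure.dt I (x, t) = ContinuousLinearMap.snd ℝ E ℝ := mfderiv_snd
        rw [h]
        rfl
      have h1 := (hRic (x, t) (u, (0 : ℝ)) (v, (0 : ℝ))).trans
        (mul_eq_zero_of_right _ (mul_eq_zero_of_left (h0 u) _))
      have h2 : ∀ r a b : ℝ, r = 0 → r + a + b = a + b := fun r a b hr ↦ by rw [hr, zero_add]
      exact (S.ricciTensor_slice hn x t u v).trans (h2 _ _ _ h1)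
    refine ⟨fun t ↦ ⟨⟨fun _ ↦ 2 * n + 2, fun _ ↦ 2 * n + 2, contMDiff_const, contMDiff_const,
      hslice t⟩, hslice t⟩, fun _ ↦ 2 * n + 2, fun _ ↦ 2 * n + 2, contMDiff_const,
      contMDiff_const, fun x u v ↦ ?_⟩
    -- At `t = 0` the factor `e^(2t)` is `1`, so the slice carries the original `η` and `g`.
    have h := hslice 0 x u v
    rw [S.slice_zero_metric] at h
    simpa [ContactMetricStructure.slice_form] using h
  · have h : mfderiv I (I.prod 𝓘(ℝ, ℝ)) (fun p : M ↦ (p, t)) x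
        = ContinuousLinearMap.inl ℝ E ℝ := mfderiv_prod_left
    rw [h]
    exact S.ricciTensor_slice hn x t u v
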